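/- Let $q$ be a prime power, let $n>1$ be an integer that is not a prime power, and let $1<k<\sigma_0(n)$, where $\sigma_0(n)$ is the number of positive divisors of $n$. Let $d_1<\dots<d_k<n$ be divisors of $n$ such that $d_i\nmid d_j$ for all $i\neq j$ and $\gcd(d_i,d_j)=1$ for all $1\le i<j\le k$. For $d\mid m\mid n$ and $x\in\mathbb{F}_{q^m}$ write $\mathrm{Tr}_{m/d}(x)=\sum_{i=0}^{m/d-1}x^{q^{di}}$, the trace of $x$ over $\mathbb{F}_{q^d}$ (all fields being regarded as subfields of $\mathbb{F}_{q^n}$). Let $a_i\in\mathbb{F}_{q^{d_i}}$ $(1\le i\le k)$ be such that $(a_1,\dots,a_k)$ is admissible, i.e. $$\mathrm{Tr}_{d_i/\gcd(d_i,d_j)}(a_i)=\mathrm{Tr}_{d_j/\gcd(d_i,d_j)}(a_j)\qquad\text{for all }1\le i<j\le k.$$ Then there exists a primitive element $\alpha\in\mathbb{F}_{q^n}$ (that is, a generator of the multiplicative group $\mathbb{F}_{q^n}^*$) such that $\mathrm{Tr}_{n/d_i}(\alpha)=a_i$ for every $1\le i\le k$, provided that one of the following holds: (a) $k\ge 3$;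 (b) $k=2$ and one of the following holds: - (b.1) $d_1\ge 5$, and moreover $q\ge 5$ if $(d_1,d_2)=(5,6)$; - (b.2) $d_1=4$ and either $d_2\ge 11$, or $d_2\ge 9$ and $q\ge 3$, or $d_2\in\{5,7\}$ and $q\ge e^{e^{6.7}}$; - (b.3) $d_1=3$ and either $d_2\ge 38$, or $d_2\ge 5$ and $q\ge e^{e^{26.1}}$. -/

import Mathlib

/-- `α` is a primitive element of the (finite) field `K`: it is a generator of the multiplicative
group of `K`. -/
def IsPrimitiveElement {K : Type*} [Field K] (α : K) : Prop :=
  ∃ u : Kˣ, (u : K) = α ∧ ∀ x : Kˣ, x ∈ Subgroup.zpowers u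

/-- The field `𝔽_{q ^ d}` inside a field `K` with `q ^ n` elements, `d ∣ n`: the elements fixed by
the `q ^ d`-power map. -/
def fieldOfOrder (K : Type*) [Field K] (q d : ℕ) : Set K :=
  {x | x ^ q ^ d = x}

/-- `Tr_{m/d}(x) = ∑_{i=0}^{m/d-1} x ^ (q ^ (d i))`, the trace from `𝔽_{q ^ m}` to `𝔽_{q ^ d}`
(used for `d ∣ m`), all fields being subfields of one field `K`. -/
def relTrace {K : Type*} [Field K] (q m d : ℕ) (x : K) : K :=
  ∑ i ∈ Finset.range (m / d), x ^ q ^ (d * i)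

/-- `Λ_k(n)`: the tuples `d_1 < ⋯ < d_k < n` of divisors of `n`, none of which divides another. -/
def DivisorTuples (k n : ℕ) : Set (Fin k → ℕ) :=
  {d | StrictMono d ∧ (∀ i, d i ∣ n ∧ d i < n) ∧ ∀ i j, i ≠ j → ¬ d i ∣ d j}

/-- `(a_1, …, a_k)` is a `(d_1, …, d_k)`-admissible tuple: `a_i ∈ 𝔽_{q ^ d_i}` for every `i` and
the traces of `a_i` and `a_j` over `𝔽_{q ^ gcd(d_i, d_j)}` agree. -/
def IsAdmissible {K : Type*} [Field K] (q : ℕ) {k : ℕ} (d : Fin k → ℕ) (a : Fin k → K) : Prop :=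
  (∀ i, a i ∈ fieldOfOrder K q (d i)) ∧
  ∀ i j, i < j →
    relTrace q (d i) (Nat.gcd (d i) (d j)) (a i) = relTrace q (d j) (Nat.gcd (d i) (d j)) (a j)

/-- The condition on `d_1`, `d_2` and `q` under which the case `k = 2` is settled. -/
def PairCondition (d₁ d₂ q : ℕ) : Prop :=
  (5 ≤ d₁ ∧ ((d₁, d₂) = (5, 6) → 5 ≤ q)) ∨
  (d₁ = 4 ∧
    (11 ≤ d₂ ∨ (9 ≤ d₂ ∧ 3 ≤ q) ∨
      ((d₂ = 5 ∨ d₂ = 7) ∧ Real.exp (Real.exp 6.7) ≤ (q : ℝ)))) ∨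
  (d₁ = 3 ∧ (38 ≤ d₂ ∨ (5 ≤ d₂ ∧ Real.exp (Real.exp 26.1) ≤ (q : ℝ))))

/-! Let the $q$-Frobenius make $K=\mathbb{F}_{q^n}$ a module over $\mathbb{Z}[X]$, and put
$g_d=1+X+\dots+X^{d-1}$, so that $\mathrm{Tr}_{n/d}$ is $(X^n-1)/(X^d-1)$. For pairwise coprime
$d_i$ the $g_{d_i}$ are pairwise comaximal in $\mathbb{Z}[X]$, hence $M=(X-1)\prod g_{d_i}$ divides
$X^n-1$. An interpolation of Chinese remainder type then shows that admissible traces are realised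
on a whole coset of $V=\ker\frac{X^n-1}{M}$, of codimension $\lambda=1+\sum(d_i-1)$ over
$\mathbb{F}_q$ (`exists_coset_of_traces`).

A nontrivial multiplicative character sums to at most $\sqrt{q^n}$ over any coset of an additive
subgroup (`MulChar.norm_sum_coset_le`). Weighting with characters of order $p$, for each prime
$p\mid q^n-1$, yields a primitive element in the coset once $4^{\omega(q^n-1)}q^{2\lambda}\le q^n$
(`exists_isPrimitiveElement_coset`, `SieveBound`).

It remains to bound $\omega$. Comparing every prime factor with $2^t$ gives $2^{t\omega(N)}\le 2^C
N$, with $C$ depending on $t$ only. With $t=8$, $C=98$ this settles all but finitely many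
$(q,d_1,d_2)$ outside the cases with huge $q$; the rest is checked by trial division. For huge $q$ a
larger $t$ is used. For $k\ge3$, all divisors after the second are replaced by their product. -/

open Polynomial

/-! ### Comaximality of the polynomials $1+X+\dots+X^{d-1}$ over $\mathbb{Z}$ -/

/-- The polynomial `1 + X + ⋯ + X ^ (d - 1)`. -/
noncomputable def geomPoly (d : ℕ) : ℤ[X] := ∑ i ∈ Finset.range d, X ^ i

theorem geomPoly_mul (d : ℕ) : geomPoly d * (X - 1) = X ^ d - 1 := geom_sum_mul X d

theorem X_pow_sub_one_monic {n : ℕ} (hn : n ≠ 0) : (X ^ n - 1 : ℤ[X]).Monic := by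
  simpa using monic_X_pow_sub_C (1 : ℤ) hn

theorem X_pow_sub_one_natDegree (n : ℕ) : (X ^ n - 1 : ℤ[X]).natDegree = n := by
  simpa using natDegree_X_pow_sub_C (n := n) (r := (1 : ℤ))

theorem X_sub_one_monic : (X - 1 : ℤ[X]).Monic := by simpa using monic_X_sub_C (1 : ℤ)

theorem geomPoly_monic {d : ℕ} (hd : d ≠ 0) : (geomPoly d).Monic :=
  X_sub_one_monic.of_mul_monic_right (by rw [geomPoly_mul]; exact X_pow_sub_one_monic hd)

theorem geomPoly_natDegree {d : ℕ} (hd : d ≠ 0) : (geomPoly d).natDegree = d - 1 := by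
  have h := congrArg natDegree (geomPoly_mul d)
  rw [(geomPoly_monic hd).natDegree_mul X_sub_one_monic, X_pow_sub_one_natDegree] at h
  have : (X - 1 : ℤ[X]).natDegree = 1 := by simpa using natDegree_X_sub_C (1 : ℤ)
  omega

theorem geomPoly_add (a b : ℕ) : geomPoly (a + b) = geomPoly a * X ^ b + geomPoly b := by
  unfold geomPoly
  rw [add_comm a b, Finset.sum_range_add, Finset.sum_mul, add_comm]
  congr 1
  exact Finset.sum_congr rfl fun i _ => by rw [pow_add, mul_comm]

/-- The Euclidean algorithm on $(a,b)$: $g_{a+b}=g_aX^b+g_b$, and $X^b$ is a unit modulo $g_b$. The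
Bézout relation has integer coefficients, so it can be applied in every characteristic. -/
theorem geomPoly_isCoprime : ∀ (s a b : ℕ), a + b ≤ s → Nat.gcd a b = 1 →
    IsCoprime (geomPoly a) (geomPoly b) := by
  have key : ∀ a b, IsCoprime (geomPoly a) (geomPoly b) →
      IsCoprime (geomPoly (a + b)) (geomPoly b) := by
    rintro a b hab
    have hX : IsCoprime (X ^ b) (geomPoly b) := by
      refine ⟨1, -(X - 1), ?_⟩
      linear_combination -(geomPoly_mul b)
    rw [geomPoly_add]
    have := (hab.mul_left hX).add_mul_left_left 1
    simpa using this
  intro s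
  induction s with
  | zero => intro a b h hg; simp_all
  | succ s ih =>
    intro a b h hg
    rcases Nat.eq_zero_or_pos a with rfl | ha
    · have : b = 1 := by simpa using hg
      subst this
      simp [geomPoly, isCoprime_one_right]
    rcases Nat.eq_zero_or_pos b with rfl | hb
    · have : a = 1 := by simpa using hg
      subst this
      simp [geomPoly, isCoprime_one_left]
    rcases le_total b a with hba | hab
    · obtain ⟨c, rfl⟩ := Nat.exists_eq_add_of_le' hba
      exact key c b (ih c b (by omega) (by simpa using hg))
    · obtain ⟨c, rfl⟩ := Nat.exists_eq_add_of_le' hab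
      exact (key c a (ih c a (by omega) (by simpa [Nat.gcd_comm] using hg))).symm

theorem geomPoly_dvd {d n : ℕ} (h : d ∣ n) : geomPoly d ∣ geomPoly n := by
  obtain ⟨m, rfl⟩ := h
  refine ⟨∑ j ∈ Finset.range m, (X ^ d) ^ j, ?_⟩
  apply mul_right_cancel₀ X_sub_one_monic.ne_zero
  rw [geomPoly_mul, mul_right_comm, geomPoly_mul, pow_mul, ← geom_sum_mul, mul_comm]

/-! ### The field as a $\mathbb{Z}[X]$-module through Frobenius -/

section Frobenius

variable {K : Type*} [Field K] (q : ℕ) (σ : K →+* K)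

/-- A ring endomorphism seen as a `ℤ`-linear endomorphism. -/
def linFrob : Module.End ℤ K := σ.toAddMonoidHom.toIntLinearMap

variable {q σ}

theorem linFrob_pow_apply (hσ : ∀ x, σ x = x ^ q) (i : ℕ) (x : K) :
    (linFrob σ ^ i) x = x ^ q ^ i := by
  induction i with
  | zero => simp
  | succ i ih =>
    rw [pow_succ', Module.End.mul_apply, ih]
    change σ _ = _
    rw [hσ, ← pow_mul, pow_succ]

theorem aeval_linFrob_apply (hσ : ∀ x, σ x = x ^ q) (f : ℤ[X]) (x : K) :
    aeval (linFrob σ) f x = ∑ i ∈ Finset.range (f.natDegree + 1), (f.coeff i : K) * x ^ q ^ i := by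
  rw [aeval_eq_sum_range, LinearMap.sum_apply]
  refine Finset.sum_congr rfl fun i _ => ?_
  rw [LinearMap.smul_apply, linFrob_pow_apply hσ, zsmul_eq_mul]

/-- The kernel consists of roots of the linearized polynomial $\sum f_iX^{q^i}$, which is nonzero of
degree $q^{\deg f}$. -/
theorem card_ker_aeval_le [Finite K] (hq : 2 ≤ q) (hσ : ∀ x, σ x = x ^ q) {f : ℤ[X]}
    (hf : f.Monic) :
    Nat.card (LinearMap.ker (aeval (linFrob σ) f)) ≤ q ^ f.natDegree := by
  classical
  set F : K[X] := ∑ i ∈ Finset.range (f.natDegree + 1), C (f.coeff i : K) * X ^ q ^ i with hF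
  have hcoeff : F.coeff (q ^ f.natDegree) = 1 := by
    rw [hF, finsetSum_coeff, Finset.sum_eq_single f.natDegree]
    · simp [hf.coeff_natDegree]
    · intro i _ hi
      have : q ^ f.natDegree ≠ q ^ i := fun h => hi (Nat.pow_right_injective hq h).symm
      simp [coeff_X_pow, this]
    · simp
  have hF0 : F ≠ 0 := fun h => by simp [h] at hcoeff
  have hdeg : F.natDegree ≤ q ^ f.natDegree := by
    refine natDegree_sum_le_of_forall_le _ _ fun i hi => ?_
    refine (natDegree_C_mul_X_pow_le _ _).trans ?_
    exact Nat.pow_le_pow_right (by omega) (by simpa [Nat.lt_succ_iff] using hi)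
  have hsub : ((LinearMap.ker (aeval (linFrob σ) f) : Submodule ℤ K) : Set K) ⊆
      (F.roots.toFinset : Set K) := by
    intro x hx
    have hx : aeval (linFrob σ) f x = 0 := hx
    rw [aeval_linFrob_apply hσ] at hx
    simp only [Finset.mem_coe, Multiset.mem_toFinset, mem_roots hF0, IsRoot.def]
    rw [hF, eval_finsetSum, ← hx]
    simp
  calc Nat.card (LinearMap.ker (aeval (linFrob σ) f))
      = ((LinearMap.ker (aeval (linFrob σ) f) : Submodule ℤ K) : Set K).ncard := rfl
    _ ≤ (F.roots.toFinset : Set K).ncard := Set.ncard_le_ncard hsub (Finset.finite_toSet _)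
    _ = F.roots.toFinset.card := Set.ncard_coe_finset _
    _ ≤ Multiset.card F.roots := Multiset.toFinset_card_le _
    _ ≤ _ := (card_roots' F).trans hdeg

/-- Since $X^n-1$ kills $K$, the range of $g$ lies in the kernel of $f$. Then $q^n=|\ker
g|\,|\mathrm{im}\,g|\le q^{\deg g}q^{\deg f}=q^n$ forces equality throughout. -/
theorem card_ker_and_range [Finite K] {n : ℕ} (hK : Nat.card K = q ^ n) (hq : 2 ≤ q)
    (hσ : ∀ x, σ x = x ^ q) {f g : ℤ[X]} (hf : f.Monic) (hg : g.Monic) (hfg : f * g = X ^ n - 1) :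
    Nat.card (LinearMap.ker (aeval (linFrob σ) g)) = q ^ g.natDegree ∧
    LinearMap.range (aeval (linFrob σ) g) = LinearMap.ker (aeval (linFrob σ) f) := by
  set A := aeval (linFrob σ) f
  set B := aeval (linFrob σ) g
  have hAB : A * B = 0 := by
    rw [← map_mul, hfg]
    ext x
    have := Fintype.ofFinite K
    have hx : x ^ q ^ n = x := by
      rw [← hK, Nat.card_eq_fintype_card]; exact FiniteField.pow_card x
    simp [linFrob_pow_apply hσ, hx]
  have hle : LinearMap.range B ≤ LinearMap.ker A := by
    rintro _ ⟨x, rfl⟩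
    exact LinearMap.congr_fun hAB x
  have hdeg : f.natDegree + g.natDegree = n := by
    rw [← hf.natDegree_mul hg, hfg, X_pow_sub_one_natDegree]
  have hA := card_ker_aeval_le hq hσ hf
  have hB := card_ker_aeval_le hq hσ hg
  have hr : Nat.card (LinearMap.range B) ≤ Nat.card (LinearMap.ker A) :=
    Nat.card_le_card_of_injective _ (Submodule.inclusion_injective hle)
  have hprod : q ^ n = Nat.card (LinearMap.ker B) * Nat.card (LinearMap.range B) := by
    rw [← hK, Submodule.card_eq_card_quotient_mul_card (LinearMap.ker B),
      Nat.card_congr (LinearMap.quotKerEquivRange B).toEquiv, mul_comm]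
  rw [← hdeg, pow_add, mul_comm] at hprod
  have hpos : 0 < q ^ f.natDegree := by positivity
  have hposg : 0 < q ^ g.natDegree := by positivity
  have h1 : Nat.card (LinearMap.ker B) = q ^ g.natDegree := by
    refine le_antisymm hB ?_
    by_contra h
    push Not at h
    have : Nat.card (LinearMap.ker B) * Nat.card (LinearMap.range B) <
        q ^ g.natDegree * q ^ f.natDegree :=
      (Nat.mul_le_mul_left _ (hr.trans hA)).trans_lt (Nat.mul_lt_mul_of_pos_right h hpos)
    omega
  refine ⟨h1, ?_⟩
  rw [h1] at hprod
  have h2 := Nat.eq_of_mul_eq_mul_left hposg hprod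
  apply SetLike.coe_injective
  refine Set.eq_of_subset_of_ncard_le hle ?_ (Set.toFinite _)
  change Nat.card (LinearMap.ker A) ≤ Nat.card (LinearMap.range B)
  exact hA.trans h2.le

theorem relTrace_eq_aeval (hσ : ∀ x, σ x = x ^ q) (m d : ℕ) (x : K) :
    relTrace q m d x = aeval (linFrob σ) (∑ i ∈ Finset.range (m / d), X ^ (d * i) : ℤ[X]) x := by
  simp [relTrace, linFrob_pow_apply hσ]

end Frobenius

theorem exists_ringHom_pow {K : Type*} [Field K] [Finite K] {q n : ℕ} (hq : IsPrimePow q)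
    (hK : Nat.card K = q ^ n) : ∃ σ : K →+* K, ∀ x, σ x = x ^ q := by
  obtain ⟨p, r, hp, hr, rfl⟩ := hq
  have hp := hp.nat_prime
  have := Fact.mk hp
  have := Fintype.ofFinite K
  have : CharP K p := by
    obtain ⟨m, hm, hc⟩ := FiniteField.card K (ringChar K)
    rw [Nat.card_eq_fintype_card, hc, ← pow_mul] at hK
    have h : ringChar K = p :=
      (Nat.prime_dvd_prime_iff_eq hm hp).1
        (hm.dvd_of_dvd_pow (hK ▸ dvd_pow_self _ (by positivity)))
    exact h ▸ ringChar.charP K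
  exact ⟨iterateFrobenius K p r, fun x => iterateFrobenius_def ..⟩

/-! ### A coset on which all traces are prescribed -/

/-- The elements with prescribed compatible traces over subfields of pairwise coprime degrees
contain a coset of an additive subgroup of the expected size. -/
theorem exists_coset_of_traces {K : Type*} [Field K] [Finite K] {q n k : ℕ} (hq : IsPrimePow q)
    (hn : n ≠ 0) (hK : Nat.card K = q ^ n) (hk : 1 < k) (d : Fin k → ℕ)
    (hdn : ∀ i, d i ∣ n) (hcop : ∀ i j, i < j → Nat.gcd (d i) (d j) = 1) (a : Fin k → K)
    (ha : IsAdmissible q d a) :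
    ∃ (V : AddSubgroup K) (α : K),
      Nat.card V * q ^ (1 + ∑ i, (d i - 1)) = q ^ n ∧
      ∀ v ∈ V, ∀ i, relTrace q n (d i) (α + v) = a i := by
  classical
  obtain ⟨σ, hσ⟩ := exists_ringHom_pow hq hK
  have hd0 : ∀ i, d i ≠ 0 := fun i h => hn (by simpa [h] using hdn i)
  have hcop' : ∀ i j, i ≠ j → IsCoprime (geomPoly (d i)) (geomPoly (d j)) := by
    intro i j hij
    rcases lt_or_gt_of_ne hij with h | h
    · exact geomPoly_isCoprime _ _ _ le_rfl (hcop i j h)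
    · exact geomPoly_isCoprime _ _ _ le_rfl ((Nat.gcd_comm _ _).trans (hcop j i h))
  set E : ℤ[X] →ₐ[ℤ] Module.End ℤ K := aeval (linFrob σ) with hE
  set P : Fin k → ℤ[X] := fun i => ∏ j ∈ Finset.univ.erase i, geomPoly (d j) with hP
  set M : ℤ[X] := (X - 1) * ∏ j, geomPoly (d j) with hM
  have hPg : ∀ i, P i * geomPoly (d i) = ∏ j, geomPoly (d j) := fun i =>
    Finset.prod_erase_mul _ _ (Finset.mem_univ i)
  have hprodmonic : (∏ j, geomPoly (d j)).Monic :=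
    monic_prod_of_monic _ _ fun i _ => geomPoly_monic (hd0 i)
  have hMm : M.Monic := X_sub_one_monic.mul hprodmonic
  have hMdeg : M.natDegree = 1 + ∑ i, (d i - 1) := by
    rw [hM, X_sub_one_monic.natDegree_mul hprodmonic,
      natDegree_prod_of_monic _ _ fun i _ => geomPoly_monic (hd0 i)]
    congr 1
    · simpa using natDegree_X_sub_C (1 : ℤ)
    · exact Finset.sum_congr rfl fun i _ => geomPoly_natDegree (hd0 i)
  -- The factor $X-1$ is kept apart: over $\mathbb{Z}$ it is not comaximal with $g_d$ for $d>1$,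
  -- because $g_d(1)=d$.
  obtain ⟨G, hG⟩ : M ∣ X ^ n - 1 := by
    rw [hM, ← geomPoly_mul, mul_comm]
    refine mul_dvd_mul_right ?_ _
    exact Finset.prod_dvd_of_coprime (fun i _ j _ hij => hcop' i j hij)
      fun i _ => geomPoly_dvd (hdn i)
  have hGm : G.Monic := hMm.of_mul_monic_left (hG ▸ X_pow_sub_one_monic hn)
  obtain ⟨hker, hrange⟩ := card_ker_and_range hK hq.two_le hσ hMm hGm hG.symm
  obtain ⟨u, hu⟩ : ∃ u : Fin k → ℤ[X], ∑ i, u i * P i = 1 := by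
    have : NeZero k := ⟨by omega⟩
    have := (exists_sum_eq_one_iff_pairwise_coprime (s := fun i => geomPoly (d i))
      (t := (Finset.univ : Finset (Fin k))) Finset.univ_nonempty).2
      (fun i j hij => by
        have : (i : Fin k) ≠ j := fun h => hij (Subtype.ext h)
        exact hcop' i j this)
    obtain ⟨μ, hμ⟩ := this
    refine ⟨μ, ?_⟩
    rw [← hμ]
    refine Finset.sum_congr rfl fun i _ => ?_
    simp only [hP, Finset.sdiff_singleton_eq_erase]
  have htr : ∀ i j, E (geomPoly (d i)) (a i) = E (geomPoly (d j)) (a j) := by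
    have h1 : ∀ i (x : K), relTrace q (d i) 1 x = E (geomPoly (d i)) x := fun i x => by
      rw [relTrace_eq_aeval hσ, hE, geomPoly]; simp
    have h2 : ∀ i j, i < j → E (geomPoly (d i)) (a i) = E (geomPoly (d j)) (a j) := by
      intro i j hij
      have := ha.2 i j hij
      rwa [hcop i j hij, h1, h1] at this
    intro i j
    rcases lt_trichotomy i j with h | rfl | h
    · exact h2 i j h
    · rfl
    · exact (h2 j i h).symm
  -- Admissibility says $g_{d_i}a_i=g_{d_j}a_j$; the product of the other $g_{d_l}$ is then applied
  -- to both sides.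
  have hPa : ∀ i j, E (P i) (a j) = E (P j) (a i) := by
    intro i j
    rcases eq_or_ne i j with rfl | hij
    · rfl
    set R := ∏ l ∈ (Finset.univ.erase i).erase j, geomPoly (d l) with hR
    have e1 : P i = R * geomPoly (d j) :=
      (Finset.prod_erase_mul _ _ (by simp [hij.symm])).symm
    have e2 : P j = R * geomPoly (d i) := by
      rw [hR, Finset.erase_right_comm]
      exact (Finset.prod_erase_mul _ _ (by simp [hij])).symm
    rw [e1, e2, map_mul, map_mul, Module.End.mul_apply, Module.End.mul_apply, htr]
  -- With $\sum u_jP_j=1$, the symmetry just shown gives $P_i\beta=\sum_j u_jP_ja_i=a_i$.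
  set β : K := ∑ j, E (u j) (a j) with hβ
  have hPβ : ∀ i, E (P i) β = a i := by
    intro i
    have : ∀ j, E (P i) (E (u j) (a j)) = E (u j * P j) (a i) := fun j => by
      rw [← Module.End.mul_apply, ← map_mul, mul_comm, map_mul, Module.End.mul_apply, hPa,
        ← Module.End.mul_apply, ← map_mul]
    rw [hβ, map_sum, Finset.sum_congr rfl fun j _ => this j, ← LinearMap.sum_apply, ← map_sum, hu,
      map_one, Module.End.one_apply]
  have hfix : ∀ i, E (X ^ d i - 1) (a i) = 0 := by
    intro i
    have : a i ^ q ^ d i = a i := ha.1 i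
    simp [hE, linFrob_pow_apply hσ, this]
  have hMβ : β ∈ LinearMap.ker (E M) := by
    have i : Fin k := ⟨0, by omega⟩
    rw [LinearMap.mem_ker, hM, ← hPg i, show (X - 1) * (P i * geomPoly (d i)) =
      (X ^ d i - 1) * P i by rw [← geomPoly_mul]; ring, map_mul, Module.End.mul_apply, hPβ, hfix]
  obtain ⟨α, hα⟩ : β ∈ LinearMap.range (E G) := hrange ▸ hMβ
  refine ⟨(LinearMap.ker (E G)).toAddSubgroup, α, ?_, ?_⟩
  · change Nat.card (LinearMap.ker (E G)) * _ = _
    rw [hker, ← hMdeg, ← pow_add, add_comm, ← hMm.natDegree_mul hGm, ← hG,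
      X_pow_sub_one_natDegree]
  · intro v hv i
    have hv : E G v = 0 := hv
    -- The trace is $(X^n-1)/(X^{d_i}-1)=MG/((X-1)g_{d_i})=P_iG$, so it kills $\ker G$ and sends
    -- $\alpha$ to $P_i\beta=a_i$.
    have hT : (∑ l ∈ Finset.range (n / d i), X ^ (d i * l) : ℤ[X]) = P i * G := by
      apply mul_right_cancel₀ (X_pow_sub_one_monic (hd0 i)).ne_zero
      simp_rw [pow_mul]
      rw [geom_sum_mul, ← pow_mul, Nat.mul_div_cancel' (hdn i), hG, hM, ← hPg i, ← geomPoly_mul]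
      ring
    rw [relTrace_eq_aeval hσ, hT, map_add]
    change E _ _ + E _ _ = _
    rw [map_mul, Module.End.mul_apply, Module.End.mul_apply, hv, map_zero, add_zero, hα, hPβ]

/-! ### Character sums over cosets of additive subgroups -/

section CharacterSums

variable {K : Type*} [Field K] [Fintype K] {χ : MulChar K ℂ}

/-- Substituting $y+w=1/s$ turns the summand into $\chi(1-ws)$ for $s\ne0$. The full sum over $s$
vanishes, and the absent term $s=0$ accounts for $-1$. -/
theorem MulChar.sum_mul_inv_add (hχ : χ ≠ 1) {w : K} (hw : w ≠ 0) :
    ∑ y, χ y * χ⁻¹ (y + w) = -1 := by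
  classical
  calc ∑ y, χ y * χ⁻¹ (y + w) = ∑ t, χ (t - w) * χ⁻¹ t :=
        Fintype.sum_equiv (Equiv.addRight w) _ _ fun y => by simp
    _ = ∑ s, χ (s⁻¹ - w) * χ⁻¹ s⁻¹ :=
        (Fintype.sum_equiv (Equiv.inv K) _ _ fun y => by simp).symm
    _ = ∑ s, (χ (1 - w * s) - if s = 0 then 1 else 0) := by
        refine Finset.sum_congr rfl fun s _ => ?_
        rw [MulChar.inv_apply', inv_inv, ← map_mul]
        rcases eq_or_ne s 0 with rfl | hs
        · simp
        · simp [hs, sub_mul]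
    _ = ∑ u, χ u - 1 := by
        rw [Finset.sum_sub_distrib]
        congr 1
        · exact Fintype.sum_equiv ((Equiv.mulLeft₀ w hw).trans (Equiv.subLeft 1)) _ _
            fun s => by simp
        · simp
    _ = -1 := by rw [MulChar.sum_eq_zero_of_ne_one hχ]; ring

theorem MulChar.sum_mul_inv_self (χ : MulChar K ℂ) :
    ∑ y, χ y * χ⁻¹ y = (Fintype.card K : ℂ) - 1 := by
  classical
  have : ∀ y : K, χ y * χ⁻¹ y = 1 - if y = 0 then 1 else 0 := by
    intro y
    rw [← MulChar.mul_apply, mul_inv_cancel]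
    rcases eq_or_ne y 0 with rfl | hy
    · simp
    · simp [hy, MulChar.one_apply (Ne.isUnit hy)]
  simp [this]

/-- The sum of a nontrivial multiplicative character over a coset of an additive subgroup is
bounded by the square root of the order of the field. -/
theorem MulChar.norm_sum_coset_le (hχ : χ ≠ 1) (V : AddSubgroup K) [Fintype V] (x : K) :
    ‖∑ v : V, χ (x + v)‖ ≤ √(Fintype.card K) := by
  classical
  set S : K → ℂ := fun y => ∑ v : V, χ (y + v) with hS
  have hcorr : ∀ v v' : V, ∑ y, χ (y + v) * χ⁻¹ (y + v') =
      (if v = v' then (Fintype.card K : ℂ) else 0) - 1 := by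
    intro v v'
    have h : ∑ y, χ (y + v) * χ⁻¹ (y + v') = ∑ y, χ y * χ⁻¹ (y + (v' - v)) :=
      Fintype.sum_equiv (Equiv.addRight (v : K)) _ _ fun y => by simp
    rw [h]
    split_ifs with hv
    · simp [hv, MulChar.sum_mul_inv_self]
    · rw [MulChar.sum_mul_inv_add hχ (by
        rw [sub_ne_zero]; exact fun h => hv (Subtype.ext h.symm))]
      ring
  have hsq : ∀ y, ((‖S y‖ ^ 2 : ℝ) : ℂ) = ∑ v : V, ∑ v' : V, χ (y + v) * χ⁻¹ (y + v') := by
    intro y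
    have : ((‖S y‖ ^ 2 : ℝ) : ℂ) = S y * star (S y) := by
      rw [RCLike.star_def, Complex.mul_conj, Complex.normSq_eq_norm_sq]
    rw [this, hS, star_sum, Finset.sum_mul_sum]
    simp only [MulChar.star_apply']
  -- The second moment over all of $K$. As $S$ is constant on cosets of $V$, the single value at $x$
  -- occurs $|V|$ times in it, which gives $|S(x)|^2\le|K|-|V|$.
  have htot : ∑ y, ‖S y‖ ^ 2 = Fintype.card V * Fintype.card K - (Fintype.card V : ℝ) ^ 2 := by
    have : ((∑ y, ‖S y‖ ^ 2 : ℝ) : ℂ) =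
        Fintype.card V * Fintype.card K - (Fintype.card V : ℂ) ^ 2 := by
      rw [Complex.ofReal_sum, Finset.sum_congr rfl fun y _ => hsq y, Finset.sum_comm]
      simp_rw [Finset.sum_comm (s := (Finset.univ : Finset K)), hcorr]
      simp [Finset.sum_sub_distrib]
      ring
    exact_mod_cast this
  have hshift : ∀ v : V, S (x + v) = S x := by
    intro v
    exact Fintype.sum_equiv (Equiv.addLeft v) _ _ fun u => by simp [add_assoc]
  have hle : ∑ v : V, ‖S (x + v)‖ ^ 2 ≤ ∑ y, ‖S y‖ ^ 2 := by
    have hinj : Function.Injective fun v : V => x + (v : K) :=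
      fun u v h => Subtype.ext (add_left_cancel h)
    rw [← Finset.sum_image (f := fun y => ‖S y‖ ^ 2) (g := fun v : V => x + (v : K))
      (fun u _ v _ h => hinj h)]
    exact Finset.sum_le_sum_of_subset_of_nonneg (Finset.subset_univ _) fun _ _ _ => by positivity
  simp only [hshift, Finset.sum_const, Finset.card_univ, nsmul_eq_mul] at hle
  rw [htot] at hle
  have hpos : (0 : ℝ) < Fintype.card V := by exact_mod_cast Fintype.card_pos
  apply Real.le_sqrt_of_sq_le
  change ‖S x‖ ^ 2 ≤ _
  nlinarith

end CharacterSums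

/-! ### Detecting elements that are not $p$-th powers -/

section PowerFree

variable {K : Type*} [Field K]

/-- The weight whose vanishing detects, factor by factor, that `χ p x = 1` for some `p ∈ S`. -/
noncomputable def powerFreeWeight (χ : ℕ → MulChar K ℂ) (S : Finset ℕ) (x : K) : ℂ :=
  ∏ p ∈ S, (1 - ((p : ℂ) - 1)⁻¹ * ∑ j ∈ Finset.Icc 1 (p - 1), (χ p ^ j) x)

/-- The coefficients of each factor of the weight have total modulus $1+1=2$, whence $2^{|S|}$. The
twisted bound carries the induction: expanding the factor at $p$ replaces $\psi$ by $\psi\chi_p^j$,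
which stays nontrivial because the order of $\psi$ is prime to $p$. -/
theorem norm_sum_powerFreeWeight_le (A : Finset K) {B : ℝ}
    (hB : ∀ χ : MulChar K ℂ, χ ≠ 1 → ‖∑ x ∈ A, χ x‖ ≤ B) (χ : ℕ → MulChar K ℂ) (S : Finset ℕ)
    (hS : ∀ p ∈ S, p.Prime) (hχ : ∀ p ∈ S, orderOf (χ p) = p) :
    (∀ ψ : MulChar K ℂ, ψ ≠ 1 → (∀ p ∈ S, (orderOf ψ).Coprime p) →
      ‖∑ x ∈ A, ψ x * powerFreeWeight χ S x‖ ≤ 2 ^ S.card * B) ∧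
    ‖∑ x ∈ A, (1 : MulChar K ℂ) x * powerFreeWeight χ S x - ∑ x ∈ A, (1 : MulChar K ℂ) x‖ ≤
      (2 ^ S.card - 1) * B := by
  classical
  induction S using Finset.induction_on with
  | empty => exact ⟨fun ψ hψ _ => by simpa [powerFreeWeight] using hB ψ hψ,
      by simp [powerFreeWeight]⟩
  | insert p S hpS ih =>
    obtain ⟨ih1, ih2⟩ := ih (fun r hr => hS r (Finset.mem_insert_of_mem hr))
      (fun r hr => hχ r (Finset.mem_insert_of_mem hr))
    have hp : p.Prime := hS p (Finset.mem_insert_self ..)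
    have hpo : orderOf (χ p) = p := hχ p (Finset.mem_insert_self ..)
    have hp1 : (0 : ℝ) < (p : ℝ) - 1 := by
      have : (1 : ℝ) < p := by exact_mod_cast hp.one_lt
      linarith
    have expand : ∀ ψ : MulChar K ℂ, ∑ x ∈ A, ψ x * powerFreeWeight χ (insert p S) x =
        ∑ x ∈ A, ψ x * powerFreeWeight χ S x - ((p : ℂ) - 1)⁻¹ *
          ∑ j ∈ Finset.Icc 1 (p - 1), ∑ x ∈ A, (ψ * χ p ^ j) x * powerFreeWeight χ S x := by
      intro ψ
      rw [Finset.sum_comm, Finset.mul_sum, ← Finset.sum_sub_distrib]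
      refine Finset.sum_congr rfl fun x _ => ?_
      rw [powerFreeWeight, Finset.prod_insert hpS, ← powerFreeWeight]
      simp only [MulChar.mul_apply, mul_assoc, mul_left_comm (ψ x)]
      rw [← Finset.sum_mul]
      ring
    have tail : ∀ ψ : MulChar K ℂ, (∀ r ∈ insert p S, (orderOf ψ).Coprime r) →
        ‖((p : ℂ) - 1)⁻¹ * ∑ j ∈ Finset.Icc 1 (p - 1),
          ∑ x ∈ A, (ψ * χ p ^ j) x * powerFreeWeight χ S x‖ ≤ 2 ^ S.card * B := by
      intro ψ hψ
      have hj : ∀ j ∈ Finset.Icc 1 (p - 1),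
          ‖∑ x ∈ A, (ψ * χ p ^ j) x * powerFreeWeight χ S x‖ ≤ 2 ^ S.card * B := by
        intro j hj
        rw [Finset.mem_Icc] at hj
        have hdvd : orderOf (χ p ^ j) ∣ p := by
          have := orderOf_pow_dvd (x := χ p) j
          rwa [hpo] at this
        refine ih1 _ ?_ ?_
        · intro h
          have h' : χ p ^ j = ψ⁻¹ := (inv_eq_of_mul_eq_one_right h).symm
          have h1 : χ p ^ j = 1 := by
            rw [← orderOf_eq_one_iff]
            refine Nat.Coprime.eq_one_of_dvd ?_ hdvd
            rw [h', orderOf_inv]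
            exact hψ p (Finset.mem_insert_self ..)
          have h2 := orderOf_dvd_of_pow_eq_one h1
          rw [hpo] at h2
          have := Nat.le_of_dvd (by omega) h2
          have := hp.one_lt
          omega
        · intro r hr
          have hrp : p.Coprime r := (Nat.coprime_primes hp (hS r (Finset.mem_insert_of_mem hr))).2
            fun h => hpS (h ▸ hr)
          refine Nat.Coprime.coprime_dvd_left
            ((Commute.all ψ (χ p ^ j)).orderOf_mul_dvd_mul_orderOf) ?_
          exact (hψ r (Finset.mem_insert_of_mem hr)).mul_left (hrp.coprime_dvd_left hdvd)
      have hn : ‖((p : ℂ) - 1)⁻¹‖ = ((p : ℝ) - 1)⁻¹ := by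
        rw [norm_inv, show (p : ℂ) - 1 = ((p - 1 : ℝ) : ℂ) by push_cast; ring, Complex.norm_real,
          Real.norm_of_nonneg hp1.le]
      rw [norm_mul, hn, inv_mul_le_iff₀ hp1]
      refine (norm_sum_le_of_le _ hj).trans ?_
      rw [Finset.sum_const, Nat.card_Icc, nsmul_eq_mul, Nat.add_sub_cancel,
        Nat.cast_sub hp.one_lt.le, Nat.cast_one]
    constructor
    · intro ψ hψ hcop
      rw [expand, Finset.card_insert_of_notMem hpS]
      have h1 := ih1 ψ hψ fun r hr => hcop r (Finset.mem_insert_of_mem hr)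
      have h2 := tail ψ hcop
      refine (norm_sub_le _ _).trans ?_
      rw [pow_succ]
      linarith
    · rw [expand, Finset.card_insert_of_notMem hpS, sub_right_comm]
      have h2 := tail 1 (by simp)
      refine (norm_sub_le _ _).trans ?_
      rw [pow_succ]
      linarith

end PowerFree

/-- An element that is not a `p`-th power for any prime `p ∣ q - 1` is primitive. -/
theorem isPrimitiveElement_of_forall_ne_pow {K : Type*} [Field K] [Finite K] {x : K} (hx : x ≠ 0)
    (h : ∀ p ∈ (Nat.card K - 1).primeFactors, ∀ y : K, y ^ p ≠ x) : IsPrimitiveElement x := by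
  obtain ⟨g, hg⟩ := IsCyclic.exists_generator (α := Kˣ)
  refine ⟨Units.mk0 x hx, rfl, ?_⟩
  have hcard : Nat.card Kˣ = Nat.card K - 1 := Nat.card_units K
  have hpos : 0 < Nat.card Kˣ := Nat.card_pos
  obtain ⟨j, hj⟩ : ∃ j : ℕ, g ^ j = Units.mk0 x hx :=
    (mem_powers_iff_mem_zpowers.2 (hg (Units.mk0 x hx)))
  have hcop : (orderOf g).Coprime j := by
    rw [orderOf_eq_card_of_forall_mem_zpowers hg]
    by_contra hne
    obtain ⟨p, hp, hp1, hp2⟩ := Nat.Prime.not_coprime_iff_dvd.1 hne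
    obtain ⟨m, rfl⟩ := hp2
    refine h p (Nat.mem_primeFactors.2 ⟨hp, hcard ▸ hp1, by omega⟩) ((g ^ m : Kˣ) : K) ?_
    rw [← Units.val_pow_eq_pow_val, ← pow_mul, mul_comm, hj, Units.val_mk0]
  intro y
  rw [← hj, ← zpow_natCast, show Subgroup.zpowers (g ^ (j : ℤ)) = Subgroup.zpowers g from ?_]
  · exact hg y
  · apply Subgroup.eq_of_le_of_card_ge
    · rw [Subgroup.zpowers_le]; exact Subgroup.zpow_mem_zpowers g j
    · rw [Nat.card_zpowers, Nat.card_zpowers, zpow_natCast, Nat.Coprime.orderOf_pow hcop]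

/-- A coset of a sufficiently large additive subgroup contains a primitive element. -/
theorem exists_isPrimitiveElement_coset {K : Type*} [Field K] [Finite K] (V : AddSubgroup K)
    (α : K) (hV : 4 ^ (Nat.card K - 1).primeFactors.card * Nat.card K ≤ Nat.card V ^ 2) :
    ∃ v ∈ V, IsPrimitiveElement (α + v) := by
  classical
  have := Fintype.ofFinite K
  have := Fintype.ofFinite V
  set S := (Nat.card K - 1).primeFactors with hS
  have hchar : ∀ p, ∃ χ : MulChar K ℂ, p ∈ S → orderOf χ = p := by
    intro p
    by_cases hp : p ∈ S
    · have hp' := Nat.mem_primeFactors.1 hp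
      have : NeZero p := ⟨hp'.1.ne_zero⟩
      obtain ⟨χ, hχ⟩ := MulChar.exists_mulChar_orderOf K (n := p)
        (by rw [← Nat.card_eq_fintype_card]; exact hp'.2.1)
        (Complex.isPrimitiveRoot_exp p hp'.1.ne_zero)
      exact ⟨χ, fun _ => hχ⟩
    · exact ⟨1, fun h => absurd h hp⟩
  choose χ hχ using hchar
  set A : Finset K := Finset.univ.image fun v : V => α + (v : K) with hA
  have hinj : Function.Injective fun v : V => α + (v : K) :=
    fun u v h => Subtype.ext (add_left_cancel h)
  have hAcard : A.card = Nat.card V := by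
    rw [hA, Finset.card_image_of_injective _ hinj, Finset.card_univ, Nat.card_eq_fintype_card]
  have hB : ∀ χ : MulChar K ℂ, χ ≠ 1 → ‖∑ x ∈ A, χ x‖ ≤ √(Nat.card K) := by
    intro χ hχ
    rw [hA, Finset.sum_image fun u _ v _ h => hinj h, Nat.card_eq_fintype_card]
    exact MulChar.norm_sum_coset_le hχ V α
  have hbound := (norm_sum_powerFreeWeight_le A hB χ S
    (fun p hp => (Nat.mem_primeFactors.1 hp).1) hχ).2
  have hne : ∑ x ∈ A, (1 : MulChar K ℂ) x * powerFreeWeight χ S x ≠ 0 := by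
    intro h0
    rw [h0, zero_sub, norm_neg] at hbound
    have hone : ∑ x ∈ A, (1 : MulChar K ℂ) x = ((A.erase 0).card : ℂ) := by
      have : ∀ x : K, (1 : MulChar K ℂ) x = if x ≠ 0 then 1 else 0 := by
        intro x
        rcases eq_or_ne x 0 with rfl | hx
        · simpa using MulChar.map_nonunit (1 : MulChar K ℂ) not_isUnit_zero
        · simp [hx, MulChar.one_apply (Ne.isUnit hx)]
      simp only [this, Finset.sum_boole]
      congr 2
      ext x
      simp [and_comm]
    rw [hone, Complex.norm_natCast] at hbound
    have h1 : (Nat.card V : ℝ) - 1 ≤ ((A.erase 0).card : ℝ) := by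
      have := Finset.pred_card_le_card_erase (s := A) (a := (0 : K))
      rw [hAcard] at this
      have h2 : Nat.card V ≤ (A.erase 0).card + 1 := by omega
      have h3 : (Nat.card V : ℝ) ≤ ((A.erase 0).card : ℝ) + 1 := by exact_mod_cast h2
      linarith
    -- The possible zero of the coset lowers the main term to $|V|-1$. This loss is absorbed because
    -- the error is $(2^\omega-1)\sqrt{|K|}$, smaller than $2^\omega\sqrt{|K|}$ by more than $1$.
    have hQ : (1 : ℝ) < √(Nat.card K) := by
      rw [Real.lt_sqrt (by norm_num)]
      have : 1 < Nat.card K := Finite.one_lt_card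
      exact_mod_cast (by simpa using this)
    have h2 : (2 : ℝ) ^ S.card * √(Nat.card K) ≤ Nat.card V := by
      apply le_of_sq_le_sq _ (by positivity)
      rw [mul_pow, Real.sq_sqrt (by positivity), ← pow_mul, mul_comm S.card, pow_mul,
        show (2 : ℝ) ^ 2 = 4 by norm_num]
      exact_mod_cast hV
    nlinarith
  obtain ⟨x, hxA, hx⟩ := Finset.exists_ne_zero_of_sum_ne_zero hne
  have hx0 : x ≠ 0 := by
    rintro rfl
    exact hx (by rw [MulChar.map_nonunit _ not_isUnit_zero, zero_mul])
  obtain ⟨v, -, rfl⟩ := Finset.mem_image.1 hxA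
  refine ⟨v, v.2, isPrimitiveElement_of_forall_ne_pow hx0 ?_⟩
  intro p hp y hy
  apply hx
  have hp' := (Nat.mem_primeFactors.1 hp).1
  have hy0 : y ≠ 0 := by
    rintro rfl
    rw [zero_pow hp'.ne_zero] at hy
    exact hx0 hy.symm
  have hval : χ p (α + v) = 1 := by
    rw [← hy, map_pow, ← MulChar.pow_apply' _ hp'.ne_zero]
    nth_rewrite 2 [← hχ p hp]
    rw [pow_orderOf_eq_one, MulChar.one_apply (Ne.isUnit hy0)]
  rw [powerFreeWeight, Finset.prod_eq_zero hp, mul_zero]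
  rw [Finset.sum_congr rfl fun j hj => show (χ p ^ j) (α + v) = 1 by
    rw [MulChar.pow_apply' _ (by have := (Finset.mem_Icc.1 hj).1; omega), hval, one_pow]]
  have : (p : ℂ) - 1 ≠ 0 := by
    rw [sub_ne_zero]; exact_mod_cast hp'.one_lt.ne'
  rw [Finset.sum_const, Nat.card_Icc, nsmul_eq_mul, Nat.add_sub_cancel,
    Nat.cast_sub hp'.one_lt.le, Nat.cast_one, mul_one, inv_mul_cancel₀ this, sub_self]

/-! ### Bounds for the number of prime factors -/

/-- The trial division primes: numbers below `2 ^ t` with no proper divisor in a fixed list of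
small primes. For `t ≤ 11` they are exactly the primes below `2 ^ t`. -/
def trialPrimes (t : ℕ) : List ℕ :=
  (List.range (2 ^ t)).filter fun p =>
    decide (2 ≤ p) && [2, 3, 5, 7, 11, 13, 17, 19, 23, 29, 31, 37, 41, 43].all
      fun m => p % m != 0 || p == m

theorem mem_trialPrimes_of_prime {t p : ℕ} (hp : p.Prime) (ht : p < 2 ^ t) :
    p ∈ trialPrimes t := by
  simp only [trialPrimes, List.mem_filter, List.mem_range, Bool.and_eq_true, decide_eq_true_eq,
    List.all_eq_true, Bool.or_eq_true, bne_iff_ne, beq_iff_eq]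
  refine ⟨ht, hp.two_le, fun m hm => ?_⟩
  by_cases h : p % m = 0
  · rcases (Nat.dvd_prime hp).1 (Nat.dvd_of_mod_eq_zero h) with h1 | h1
    · subst h1; simp at hm
    · exact Or.inr h1.symm
  · exact Or.inl h

theorem le_of_mem_trialPrimes {t p : ℕ} (h : p ∈ trialPrimes t) : p ≤ 2 ^ t :=
  (List.mem_range.1 (List.mem_filter.1 h).1).le

theorem trialPrimes_nodup (t : ℕ) : (trialPrimes t).Nodup := List.nodup_range.filter _

/-- Bound for the number of prime factors in terms of a set `F` containing the small ones. -/
theorem two_pow_card_primeFactors_mul_prod_le {t N : ℕ} (hN : N ≠ 0) (F : Finset ℕ)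
    (hF : ∀ p, p.Prime → p ∣ N → p < 2 ^ t → p ∈ F) (hF' : ∀ p ∈ F, p ≤ 2 ^ t) :
    2 ^ (t * N.primeFactors.card) * ∏ p ∈ F, p ≤ 2 ^ (t * F.card) * N := by
  classical
  set small := N.primeFactors.filter (· < 2 ^ t)
  set large := N.primeFactors.filter (¬ · < 2 ^ t)
  have hsF : small ⊆ F := by
    intro p hp
    obtain ⟨h1, h2⟩ := Finset.mem_filter.1 hp
    have := Nat.mem_primeFactors.1 h1
    exact hF p this.1 this.2.1 h2
  have hcard : small.card + large.card = N.primeFactors.card :=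
    Finset.card_filter_add_card_filter_not _
  have hprod : (∏ p ∈ small, p) * ∏ p ∈ large, p ≤ N := by
    rw [Finset.prod_filter_mul_prod_filter_not]
    exact Nat.le_of_dvd (Nat.pos_of_ne_zero hN) (Nat.prod_primeFactors_dvd N)
  have hlarge : 2 ^ (t * large.card) ≤ ∏ p ∈ large, p := by
    rw [pow_mul]
    exact Finset.pow_card_le_prod _ _ _ fun p hp => not_lt.1 (Finset.mem_filter.1 hp).2
  -- Superfluous elements of $F$ only weaken the bound, each contributing a factor $2^t/p\ge1$.
  have hrest : ∏ p ∈ F \ small, p ≤ 2 ^ (t * (F \ small).card) := by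
    rw [pow_mul]
    exact Finset.prod_le_pow_card _ _ _ fun p hp => hF' p (Finset.mem_sdiff.1 hp).1
  have hFcard : (F \ small).card + small.card = F.card := Finset.card_sdiff_add_card_eq_card hsF
  rw [← hcard, ← hFcard, ← Finset.prod_sdiff hsF, mul_add, mul_add, pow_add, pow_add]
  calc 2 ^ (t * small.card) * 2 ^ (t * large.card) * ((∏ p ∈ F \ small, p) * ∏ p ∈ small, p)
      ≤ 2 ^ (t * small.card) * (∏ p ∈ large, p) *
          (2 ^ (t * (F \ small).card) * ∏ p ∈ small, p) := by gcongr
    _ = 2 ^ (t * (F \ small).card) * 2 ^ (t * small.card) *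
          ((∏ p ∈ small, p) * ∏ p ∈ large, p) := by ring
    _ ≤ _ := by gcongr

theorem List.prod_eq_prod_toFinset {L : List ℕ} (h : L.Nodup) : ∏ p ∈ L.toFinset, p = L.prod := by
  rw [List.prod_toFinset _ h, List.map_id']

theorem two_pow_card_primeFactors_le_of_prod {t C : ℕ}
    (hC : 2 ^ (t * (trialPrimes t).length) ≤ 2 ^ C * (trialPrimes t).prod) {N : ℕ} (hN : N ≠ 0) :
    2 ^ (t * N.primeFactors.card) ≤ 2 ^ C * N := by
  have h := two_pow_card_primeFactors_mul_prod_le (t := t) hN (trialPrimes t).toFinset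
    (fun p hp _ hlt => List.mem_toFinset.2 (mem_trialPrimes_of_prime hp hlt))
    (fun p hp => le_of_mem_trialPrimes (List.mem_toFinset.1 hp))
  rw [List.prod_eq_prod_toFinset (trialPrimes_nodup t),
    List.toFinset_card_of_nodup (trialPrimes_nodup t)] at h
  have hpos : 0 < (trialPrimes t).prod := by
    rcases Nat.eq_zero_or_pos (trialPrimes t).prod with h0 | h0
    · rw [h0, mul_zero] at hC
      exact absurd hC (by simp)
    · exact h0
  refine Nat.le_of_mul_le_mul_right ?_ hpos
  calc _ ≤ _ := h
    _ ≤ 2 ^ C * (trialPrimes t).prod * N := Nat.mul_le_mul_right _ hC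
    _ = _ := by ring

/-- A crude constant needing no list of primes, for a $t$ too large for enumeration. -/
theorem two_pow_card_primeFactors_le (t : ℕ) {N : ℕ} (hN : N ≠ 0) :
    2 ^ (t * N.primeFactors.card) ≤ 2 ^ (t * 2 ^ t) * N := by
  have h := two_pow_card_primeFactors_mul_prod_le (t := t) hN (Finset.Icc 1 (2 ^ t))
    (fun p hp _ hlt => Finset.mem_Icc.2 ⟨hp.one_lt.le, hlt.le⟩)
    (fun p hp => (Finset.mem_Icc.1 hp).2)
  rw [Nat.card_Icc, Nat.add_sub_cancel] at h
  refine le_trans (Nat.le_mul_of_pos_right _ ?_) h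
  exact Finset.prod_pos fun p hp => (Finset.mem_Icc.1 hp).1

/-! ### Sufficient conditions for the sieve inequality -/

/-- The inequality under which an affine subspace of codimension `lam` over `𝔽_q` of the field
with `q ^ n` elements contains a primitive element. -/
def SieveBound (q n lam : ℕ) : Prop :=
  4 ^ (q ^ n - 1).primeFactors.card * q ^ (2 * lam) ≤ q ^ n

theorem SieveBound.mono {q n l m : ℕ} (hq : 0 < q) (h : SieveBound q n m) (hlm : l ≤ m) :
    SieveBound q n l :=
  le_trans (Nat.mul_le_mul_left _ (Nat.pow_le_pow_right hq (by omega))) h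

theorem pow_sub_one_ne_zero {q n : ℕ} (hq : 2 ≤ q) (hn : n ≠ 0) : q ^ n - 1 ≠ 0 := by
  have := Nat.one_lt_pow hn (by omega : 1 < q)
  omega

/-- The $t$-th power of the sieve inequality is compared with the square of $2^{t\omega}\le2^CN$;
the constant $2^{2C}$ is paid for by $q^m$. -/
theorem sieveBound_of_uniform {t C : ℕ} (ht : t ≠ 0)
    (H : ∀ N : ℕ, N ≠ 0 → 2 ^ (t * N.primeFactors.card) ≤ 2 ^ C * N) {q n lam m : ℕ}
    (hq : 2 ≤ q) (hn : n ≠ 0) (hm : 2 ^ (2 * C) ≤ q ^ m) (h : 2 * t * lam + 2 * n + m ≤ t * n) :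
    SieveBound q n lam := by
  have h1 := H _ (pow_sub_one_ne_zero hq hn)
  unfold SieveBound
  rw [← Nat.pow_le_pow_iff_left ht]
  set w := (q ^ n - 1).primeFactors.card
  calc (4 ^ w * q ^ (2 * lam)) ^ t = (2 ^ (t * w)) ^ 2 * q ^ (2 * t * lam) := by
        rw [show 4 ^ w = 2 ^ (2 * w) by rw [pow_mul]; norm_num]; ring
    _ ≤ (2 ^ C * q ^ n) ^ 2 * q ^ (2 * t * lam) := by
        gcongr
        exact h1.trans (Nat.mul_le_mul_left _ (Nat.sub_le _ _))
    _ = 2 ^ (2 * C) * (q ^ (2 * n) * q ^ (2 * t * lam)) := by ring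
    _ ≤ q ^ m * (q ^ (2 * n) * q ^ (2 * t * lam)) := by gcongr
    _ = q ^ (2 * t * lam + 2 * n + m) := by ring
    _ ≤ q ^ (t * n) := Nat.pow_le_pow_right (by omega) h
    _ = (q ^ n) ^ t := by ring

/-- The primes below `2 ^ 7`. -/
def primesSeven : List ℕ :=
  [2, 3, 5, 7, 11, 13, 17, 19, 23, 29, 31, 37, 41, 43, 47, 53, 59, 61, 67, 71, 73, 79, 83, 89, 97,
    101, 103, 107, 109, 113, 127]

theorem primesSeven_eq : primesSeven = trialPrimes 7 := by decide +kernel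

/-- The primes below `2 ^ 8`. -/
def primesEight : List ℕ :=
  [2, 3, 5, 7, 11, 13, 17, 19, 23, 29, 31, 37, 41, 43, 47, 53, 59, 61, 67, 71, 73, 79, 83,
    89, 97, 101, 103, 107, 109, 113, 127, 131, 137, 139, 149, 151, 157, 163, 167, 173, 179, 181, 191, 193, 197, 199, 211, 223, 227, 229, 233, 239, 241, 251]

theorem primesEight_eq : primesEight = trialPrimes 8 := by decide +kernel

theorem two_pow_eight_mul_card_primeFactors_le {N : ℕ} (hN : N ≠ 0) :
    2 ^ (8 * N.primeFactors.card) ≤ 2 ^ 98 * N := by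
  refine two_pow_card_primeFactors_le_of_prod ?_ hN
  rw [← primesEight_eq]
  decide +kernel

theorem two_pow_eleven_mul_card_primeFactors_le {N : ℕ} (hN : N ≠ 0) :
    2 ^ (11 * N.primeFactors.card) ≤ 2 ^ 550 * N := by
  refine two_pow_card_primeFactors_le_of_prod ?_ hN
  decide +kernel

theorem sieveBound_of_two_pow_le {q n lam m : ℕ} (hq : 2 ≤ q) (hn : n ≠ 0)
    (hm : 2 ^ 98 ≤ q ^ m) (h : 8 * lam + m ≤ 3 * n) : SieveBound q n lam := by
  refine sieveBound_of_uniform (t := 8) (m := 2 * m) (by norm_num)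
    (fun N hN => two_pow_eight_mul_card_primeFactors_le hN) hq hn ?_ (by omega)
  rw [mul_comm 2, mul_comm 2, pow_mul, pow_mul]
  exact Nat.pow_le_pow_left hm 2

theorem sieveBound_of_le {q n lam : ℕ} (hq : 2 ≤ q) (hn : n ≠ 0) (h : 8 * lam + 98 ≤ 3 * n) :
    SieveBound q n lam :=
  sieveBound_of_two_pow_le hq hn (Nat.pow_le_pow_left hq 98) h

/-- Trial division of `(q ^ n - 1) / r` by the primes in `L`, all those below `2 ^ t`, shows that
`4 ^ ω(q ^ n - 1) ≤ q ^ e`. -/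
def omegaCheck (L : List ℕ) (t q n e r : ℕ) : Bool :=
  Nat.beq (Nat.mod (q ^ n - 1) r) 0 &&
    Nat.beq (Nat.mod (((q ^ n - 1) / r) ^ 8) (q ^ n - 1)) 0 &&
    Nat.blt (2 ^ (t * (L.filter fun p => Nat.beq (Nat.mod ((q ^ n - 1) / r) p) 0).length) *
        ((q ^ n - 1) / r))
      ((L.filter fun p => Nat.beq (Nat.mod ((q ^ n - 1) / r) p) 0).prod *
        2 ^ (t * (Nat.log2 (q ^ e) / 2 + 1)))

theorem four_pow_le_of_omegaCheck {t q n e r : ℕ} (hq : 2 ≤ q) (hn : n ≠ 0)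
    (h : omegaCheck (trialPrimes t) t q n e r = true) :
    4 ^ (q ^ n - 1).primeFactors.card ≤ q ^ e := by
  have hN := pow_sub_one_ne_zero hq hn
  simp only [omegaCheck, Bool.and_eq_true, Nat.beq_eq, Nat.blt_eq] at h
  set N := q ^ n - 1
  set M := N / r with hMdef
  set D := (trialPrimes t).filter fun p => Nat.beq (Nat.mod M p) 0 with hD
  obtain ⟨⟨h1, h2⟩, h3⟩ := h
  have hMN : M ∣ N := Nat.div_dvd_of_dvd (Nat.dvd_of_mod_eq_zero h1)
  have hM : M ≠ 0 := ne_zero_of_dvd_ne_zero hN hMN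
  -- $N$ divides $M^8$, so passing to $M=N/r$ loses no prime factor while sharpening the bound.
  have hpf : N.primeFactors = M.primeFactors := by
    apply Finset.Subset.antisymm
    · have := Nat.primeFactors_mono (Nat.dvd_of_mod_eq_zero h2) (pow_ne_zero 8 hM)
      rwa [Nat.primeFactors_pow _ (by norm_num)] at this
    · exact Nat.primeFactors_mono hMN hN
  have hDn : D.Nodup := (trialPrimes_nodup t).filter _
  have key := two_pow_card_primeFactors_mul_prod_le (t := t) hM D.toFinset
    (fun p hp hpM hlt => by
      rw [List.mem_toFinset, hD, List.mem_filter]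
      exact ⟨mem_trialPrimes_of_prime hp hlt, by rw [Nat.beq_eq]; exact Nat.mod_eq_zero_of_dvd hpM⟩)
    (fun p hp => le_of_mem_trialPrimes (List.mem_filter.1 (List.mem_toFinset.1 hp)).1)
  rw [List.prod_eq_prod_toFinset hDn, List.toFinset_card_of_nodup hDn] at key
  have hlt := key.trans_lt h3
  rw [mul_comm] at hlt
  have hlt' := Nat.lt_of_mul_lt_mul_left hlt
  rw [Nat.pow_lt_pow_iff_right (by norm_num)] at hlt'
  -- Strictness gives $\omega<\lfloor\log_2(q^e)/2\rfloor+1$, that is, $2\omega\le\log_2(q^e)$.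
  have hw := Nat.lt_of_mul_lt_mul_left hlt'
  rw [hpf, show 4 = 2 ^ 2 by norm_num, ← pow_mul]
  calc 2 ^ (2 * M.primeFactors.card) ≤ 2 ^ Nat.log2 (q ^ e) :=
        Nat.pow_le_pow_right (by norm_num) (by omega)
    _ ≤ q ^ e := Nat.log2_self_le (by positivity)

/-- A decidable sufficient condition for `SieveBound`. -/
def sieveCheck (q n lam : ℕ) : Bool :=
  Nat.ble (2 ^ 98) (q ^ (3 * n - 8 * lam)) ||
    Nat.ble (2 * lam) n && (omegaCheck primesSeven 7 q n (n - 2 * lam) 1 ||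
      omegaCheck primesEight 8 q n (n - 2 * lam) 1 || [1, 8, 9].any (omegaCheck (trialPrimes 10) 10 q n (n - 2 * lam)))

theorem sieveBound_of_sieveCheck {q n lam : ℕ} (hq : 2 ≤ q) (hn : n ≠ 0)
    (h : sieveCheck q n lam = true) : SieveBound q n lam := by
  simp only [sieveCheck, Bool.or_eq_true, Bool.and_eq_true, Nat.ble_eq, List.any_eq_true] at h
  rcases h with h | ⟨hle, h⟩
  · refine sieveBound_of_two_pow_le hq hn h ?_
    have : 3 * n - 8 * lam ≠ 0 := by
      intro h0
      rw [h0] at h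
      norm_num at h
    omega
  · have h4 : 4 ^ (q ^ n - 1).primeFactors.card ≤ q ^ (n - 2 * lam) := by
      rcases h with (h | h) | ⟨r, -, h⟩
      · exact four_pow_le_of_omegaCheck hq hn (primesSeven_eq ▸ h)
      · exact four_pow_le_of_omegaCheck hq hn (primesEight_eq ▸ h)
      · exact four_pow_le_of_omegaCheck hq hn h
    unfold SieveBound
    calc _ ≤ q ^ (n - 2 * lam) * q ^ (2 * lam) := Nat.mul_le_mul_right _ h4
      _ = q ^ n := by rw [← pow_add, Nat.sub_add_cancel hle]

/-! ### Finite verifications -/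

/-- Here $3n-8\lambda=d-16$, which is at least $98$ for $d\ge114$ and at least $22$ for $d\ge38$,
where $23^{22}\ge2^{98}$; outside this range `sieveBound_of_two_pow_le` suffices. The ranges of the
other checks arise in the same way. -/
theorem sieveCheck_three : ∀ d < 114, 38 ≤ d → d % 3 ≠ 0 → ∀ q < 23, 2 ≤ q →
    sieveCheck q (3 * d) (d + 2) = true := by decide +kernel

theorem sieveCheck_four : ∀ d < 31, 11 ≤ d → d % 2 ≠ 0 → ∀ q < 30, 2 ≤ q →
    sieveCheck q (4 * d) (d + 3) = true := by decide +kernel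

theorem sieveCheck_four_nine : ∀ q < 288, 3 ≤ q → sieveCheck q 36 12 = true := by decide +kernel

theorem sieveCheck_five_six : ∀ q < 892, 5 ≤ q → sieveCheck q 30 10 = true := by decide +kernel

theorem sieveCheck_five_to_eight : ∀ c ∈ [5, 6, 7, 8], ∀ d < 19, c < d → Nat.gcd c d = 1 →
    ¬(c = 5 ∧ d = 6) → ∀ q < 55, 2 ≤ q → sieveCheck q (c * d) (c + d - 1) = true := by
  decide +kernel

theorem sieveCheck_two_three : ∀ c ∈ [5, 7, 11], ∀ q < 14, 2 ≤ q →
    sieveCheck q (6 * c) (c + 3) = true := by decide +kernel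

/-! ### Two divisors -/

theorem sieveBound_five_le {c d m q : ℕ} (hc : 5 ≤ c) (hcd : c < d) (hg : Nat.gcd c d = 1)
    (hm : 1 ≤ m) (hq : 2 ≤ q) (h56 : c = 5 → d = 6 → 5 ≤ q) :
    SieveBound q (c * d * m) (c + d - 1) := by
  have hc0 : 0 < c := by omega
  have hd0 : 0 < d := by omega
  have hn : c * d * m ≠ 0 := by positivity
  rcases Nat.lt_or_ge 1 m with hm1 | hm1
  · refine sieveBound_of_le hq hn ?_
    obtain ⟨x, rfl⟩ := Nat.exists_eq_add_of_le hc
    obtain ⟨y, rfl⟩ := Nat.exists_eq_add_of_lt hcd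
    have : (5 + x) * (5 + x + y + 1) * 2 ≤ (5 + x) * (5 + x + y + 1) * m :=
      Nat.mul_le_mul_left _ hm1
    have h2 : 8 * (5 + x + (5 + x + y + 1) - 1) = 80 + 16 * x + 8 * y := by omega
    rw [h2]
    nlinarith [Nat.zero_le (x * y), Nat.zero_le (x * x)]
  obtain rfl : m = 1 := by omega
  rw [mul_one] at hn ⊢
  rcases Nat.lt_or_ge c 9 with hc9 | hc9
  · by_cases h : c = 5 ∧ d = 6
    · obtain ⟨rfl, rfl⟩ := h
      rcases Nat.lt_or_ge q 892 with hq' | hq'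
      · exact sieveBound_of_sieveCheck hq hn (sieveCheck_five_six q hq' (h56 rfl rfl))
      · exact sieveBound_of_two_pow_le (m := 10) hq hn
          (le_trans (by norm_num) (Nat.pow_le_pow_left hq' 10)) (by norm_num)
    · rcases Nat.lt_or_ge d 19 with hd | hd
      · rcases Nat.lt_or_ge q 55 with hq' | hq'
        · refine sieveBound_of_sieveCheck hq hn
            (sieveCheck_five_to_eight c ?_ d hd hcd hg h q hq' hq)
          simp only [List.mem_cons, List.not_mem_nil, or_false]
          omega
        · refine sieveBound_of_two_pow_le (m := 17) hq hn
            (le_trans (by norm_num) (Nat.pow_le_pow_left hq' 17)) ?_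
          have : 5 ≤ c := hc
          interval_cases c <;> omega
      · refine sieveBound_of_le hq hn ?_
        interval_cases c <;> omega
  · refine sieveBound_of_le hq hn ?_
    obtain ⟨x, rfl⟩ := Nat.exists_eq_add_of_le hc9
    obtain ⟨y, rfl⟩ := Nat.exists_eq_add_of_lt hcd
    have h2 : 8 * (9 + x + (9 + x + y + 1) - 1) = 144 + 16 * x + 8 * y := by omega
    rw [h2]
    nlinarith [Nat.zero_le (x * y), Nat.zero_le (x * x)]

theorem two_pow_le_of_exp_exp_le {C q : ℕ} {y : ℝ} (hC : (C : ℝ) * 0.6931471808 ≤ Real.exp y)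
    (hq : Real.exp (Real.exp y) ≤ q) : 2 ^ C ≤ q := by
  have h : (2 : ℝ) ^ C ≤ q := by
    refine le_trans ?_ hq
    rw [← Real.exp_log (show (0 : ℝ) < 2 ^ C by positivity), Real.log_pow]
    apply Real.exp_le_exp.2
    refine le_trans ?_ hC
    exact mul_le_mul_of_nonneg_left Real.log_two_lt_d9.le (by positivity)
  exact_mod_cast h

theorem pow_le_exp {y : ℝ} (n : ℕ) (h : (n : ℝ) ≤ y) : (2.718 : ℝ) ^ n ≤ Real.exp y := by
  refine le_trans ?_ (Real.exp_le_exp.2 h)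
  rw [← mul_one (n : ℝ), Real.exp_nat_mul]
  gcongr
  exact le_trans (by norm_num) Real.exp_one_gt_d9.le

theorem sieveBound_four {d m q : ℕ} (hd : 4 < d) (hg : Nat.gcd 4 d = 1) (hm : 1 ≤ m) (hq : 2 ≤ q)
    (h : 11 ≤ d ∨ (9 ≤ d ∧ 3 ≤ q) ∨
      ((d = 5 ∨ d = 7) ∧ Real.exp (Real.exp 6.7) ≤ (q : ℝ))) :
    SieveBound q (4 * d * m) (4 + d - 1) := by
  have hn : 4 * d * m ≠ 0 := by positivity
  have hodd : d % 2 ≠ 0 := by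
    intro h0
    have h1 := Nat.dvd_gcd (show 2 ∣ 4 by norm_num) (Nat.dvd_of_mod_eq_zero h0)
    rw [hg] at h1
    omega
  have hbig : Real.exp (Real.exp 6.7) ≤ (q : ℝ) → 2 ^ 275 ≤ q := by
    refine two_pow_le_of_exp_exp_le (le_trans ?_ (pow_le_exp 6 (by norm_num)))
    norm_num
  have hmul : 4 * d ≤ 4 * d * m := Nat.le_mul_of_pos_right _ hm
  by_cases h9 : d < 9
  · have h57 : d = 5 ∨ d = 7 := by omega
    have hq' : 2 ^ 275 ≤ q := hbig (by
      rcases h with h | h | h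
      · omega
      · omega
      · exact h.2)
    -- $2^{2\cdot550}=(2^{275})^4$ gives the exponent $4$. The degree condition is an equality for
    -- $d=5$ and $n=20$: $22\cdot8+2\cdot20+4=11\cdot20$.
    refine sieveBound_of_uniform (t := 11) (C := 550) (m := 4) (by norm_num)
      (fun N hN => two_pow_eleven_mul_card_primeFactors_le hN) hq hn ?_ (by omega)
    exact le_trans (by rw [← pow_mul]) (Nat.pow_le_pow_left hq' 4)
  have h' : 11 ≤ d ∨ (9 ≤ d ∧ 3 ≤ q) := by omega
  rcases Nat.lt_or_ge 1 m with hm1 | hm1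
  · refine sieveBound_of_le hq hn ?_
    have : 4 * d * 2 ≤ 4 * d * m := Nat.mul_le_mul_left _ hm1
    omega
  obtain rfl : m = 1 := by omega
  rw [mul_one] at hn ⊢
  rcases Nat.lt_or_ge d 11 with h11 | h11
  · obtain rfl : d = 9 := by omega
    rcases Nat.lt_or_ge q 288 with hq' | hq'
    · exact sieveBound_of_sieveCheck hq hn (sieveCheck_four_nine q hq' (by omega))
    · exact sieveBound_of_two_pow_le (m := 12) hq hn
        (le_trans (by norm_num) (Nat.pow_le_pow_left hq' 12)) (by norm_num)
  · rcases Nat.lt_or_ge d 31 with h31 | h31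
    · rcases Nat.lt_or_ge q 30 with hq' | hq'
      · rw [show 4 + d - 1 = d + 3 by omega]
        exact sieveBound_of_sieveCheck hq hn (sieveCheck_four d h31 h11 hodd q hq' hq)
      · exact sieveBound_of_two_pow_le (m := 20) hq hn
          (le_trans (by norm_num) (Nat.pow_le_pow_left hq' 20)) (by omega)
    · exact sieveBound_of_le hq hn (by omega)

theorem sieveBound_three {d m q : ℕ} (hg : Nat.gcd 3 d = 1) (hm : 1 ≤ m) (hq : 2 ≤ q)
    (h : 38 ≤ d ∨ (5 ≤ d ∧ Real.exp (Real.exp 26.1) ≤ (q : ℝ))) :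
    SieveBound q (3 * d * m) (3 + d - 1) := by
  have hn : 3 * d * m ≠ 0 := by
    have : 0 < d := by omega
    positivity
  have h3 : d % 3 ≠ 0 := by
    intro h0
    have h1 := Nat.dvd_gcd (dvd_refl 3) (Nat.dvd_of_mod_eq_zero h0)
    rw [hg] at h1
    omega
  have hmul : 3 * d ≤ 3 * d * m := Nat.le_mul_of_pos_right _ hm
  rcases h with h | ⟨h5, hqbig⟩
  · rcases Nat.lt_or_ge 1 m with hm1 | hm1
    · refine sieveBound_of_le hq hn ?_
      have : 3 * d * 2 ≤ 3 * d * m := Nat.mul_le_mul_left _ hm1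
      omega
    obtain rfl : m = 1 := by omega
    rw [mul_one] at hn ⊢
    rcases Nat.lt_or_ge d 114 with h114 | h114
    · rcases Nat.lt_or_ge q 23 with hq' | hq'
      · rw [show 3 + d - 1 = d + 2 by omega]
        exact sieveBound_of_sieveCheck hq hn (sieveCheck_three d h114 h h3 q hq' hq)
      · exact sieveBound_of_two_pow_le (m := 22) hq hn
          (le_trans (by norm_num) (Nat.pow_le_pow_left hq' 22)) (by omega)
    · exact sieveBound_of_le hq hn (by omega)
  · obtain ⟨C, hC⟩ : ∃ C : ℕ, C = 31 * 2 ^ 31 := ⟨_, rfl⟩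
    -- The tightest case is $n=15$, $\lambda=7$, where $14t+30+1\le15t$ makes $t=31$ the least
    -- choice.
    refine sieveBound_of_uniform (t := 31) (C := C) (m := 1) (by norm_num)
      (fun N hN => hC ▸ two_pow_card_primeFactors_le 31 hN) hq hn ?_ (by omega)
    rw [pow_one]
    refine two_pow_le_of_exp_exp_le (le_trans ?_ (pow_le_exp 26 (by norm_num))) hqbig
    rw [hC]
    push_cast
    norm_num

theorem sieveBound_of_pairCondition {c d m q : ℕ} (hcd : c < d) (hg : Nat.gcd c d = 1)
    (hm : 1 ≤ m) (hq : 2 ≤ q) (h : PairCondition c d q) :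
    SieveBound q (c * d * m) (c + d - 1) := by
  rcases h with ⟨h5, h56⟩ | ⟨rfl, h⟩ | ⟨rfl, h⟩
  · exact sieveBound_five_le h5 hcd hg hm hq fun h1 h2 => h56 (by rw [h1, h2])
  · exact sieveBound_four hcd hg hm hq h
  · exact sieveBound_three hg hm hq h

/-! ### Three or more divisors -/

/-- The product outgrows the sum: $8\lambda+98\le3n$ fails only for $(2,3,c)$ with $c\in\{5,7,11\}$
and $m=1$. -/
theorem sieveBound_triple {a b c m q : ℕ} (ha : 2 ≤ a) (hab : a < b) (hbc : b < c)
    (hgab : Nat.gcd a b = 1) (hgac : Nat.gcd a c = 1) (hgbc : Nat.gcd b c = 1)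
    (hm : 1 ≤ m) (hq : 2 ≤ q) : SieveBound q (a * b * c * m) (a + b + c - 2) := by
  have hb0 : 0 < b := by omega
  have hc0 : 0 < c := by omega
  have hn : a * b * c * m ≠ 0 := by positivity
  have hmul : a * b * c ≤ a * b * c * m := Nat.le_mul_of_pos_right _ hm
  have hnd : ∀ {p x y : ℕ}, 2 ≤ p → p ∣ x → Nat.gcd x y = 1 → y % p ≠ 0 := by
    intro p x y hp hpx hxy h0
    have h1 := Nat.dvd_gcd hpx (Nat.dvd_of_mod_eq_zero h0)
    rw [hxy] at h1
    have := Nat.le_of_dvd one_pos h1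
    omega
  by_cases h23 : a = 2 ∧ b = 3
  · obtain ⟨rfl, rfl⟩ := h23
    have h2 := hnd le_rfl (dvd_refl 2) hgac
    have h3 := hnd (by norm_num) (dvd_refl 3) hgbc
    rcases Nat.lt_or_ge 1 m with hm1 | hm1
    · have : 2 * 3 * c * 2 ≤ 2 * 3 * c * m := Nat.mul_le_mul_left _ hm1
      exact sieveBound_of_le hq hn (by omega)
    obtain rfl : m = 1 := by omega
    rw [mul_one] at hn ⊢
    rcases Nat.lt_or_ge c 13 with hc | hc
    · rcases Nat.lt_or_ge q 14 with hq' | hq'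
      · rw [show 2 + 3 + c - 2 = c + 3 by omega]
        refine sieveBound_of_sieveCheck hq hn (sieveCheck_two_three c ?_ q hq' hq)
        simp only [List.mem_cons, List.not_mem_nil, or_false]
        omega
      · exact sieveBound_of_two_pow_le (m := 26) hq hn
          (le_trans (by norm_num) (Nat.pow_le_pow_left hq' 26)) (by omega)
    · exact sieveBound_of_le hq hn (by omega)
  · refine sieveBound_of_le hq hn (le_trans ?_ (Nat.mul_le_mul_left 3 hmul))
    rcases Nat.lt_or_ge a 4 with ha4 | ha4
    · interval_cases a
      · have h2 := hnd le_rfl (dvd_refl 2) hgab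
        have h2' := hnd le_rfl (dvd_refl 2) hgac
        have hb : 5 ≤ b := by omega
        have hc : b + 2 ≤ c := by omega
        obtain ⟨x, rfl⟩ := Nat.exists_eq_add_of_le hb
        obtain ⟨y, rfl⟩ := Nat.exists_eq_add_of_le hc
        have : 8 * (2 + (5 + x) + (5 + x + 2 + y) - 2) = 96 + 16 * x + 8 * y := by omega
        rw [this]
        nlinarith [Nat.zero_le (x * y), Nat.zero_le (x * x)]
      · obtain ⟨x, rfl⟩ := Nat.exists_eq_add_of_lt hab
        obtain ⟨y, rfl⟩ := Nat.exists_eq_add_of_lt hbc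
        have : 8 * (3 + (3 + x + 1) + (3 + x + 1 + y + 1) - 2) = 80 + 16 * x + 8 * y := by omega
        rw [this]
        nlinarith [Nat.zero_le (x * y), Nat.zero_le (x * x)]
    · have h1 : a + b + c ≤ 3 * c := by omega
      have h2 : 4 * 5 ≤ a * b := Nat.mul_le_mul ha4 (by omega)
      have h3 : 4 * 5 * c ≤ a * b * c := Nat.mul_le_mul_right _ h2
      omega

theorem sum_sub_one_le_prod_sub_one {ι : Type*} (s : Finset ι) (f : ι → ℕ)
    (hf : ∀ i ∈ s, 1 ≤ f i) : ∑ i ∈ s, (f i - 1) ≤ ∏ i ∈ s, f i - 1 := by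
  classical
  induction s using Finset.induction_on with
  | empty => simp
  | insert i s hi ih =>
    rw [Finset.sum_insert hi, Finset.prod_insert hi]
    have h1 := hf i (Finset.mem_insert_self ..)
    have h2 := ih fun j hj => hf j (Finset.mem_insert_of_mem hj)
    have h3 : 1 ≤ ∏ j ∈ s, f j := Nat.succ_le_of_lt
      (Finset.prod_pos fun j hj => Nat.lt_of_succ_le (hf j (Finset.mem_insert_of_mem hj)))
    obtain ⟨x, hx⟩ := Nat.exists_eq_add_of_le h1
    obtain ⟨y, hy⟩ := Nat.exists_eq_add_of_le h3
    rw [hy] at h2 ⊢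
    rw [hx]
    have : (1 + x) * (1 + y) = 1 + (x + y + x * y) := by ring
    rw [this]
    simp only [Nat.add_sub_cancel_left] at h2 ⊢
    exact (Nat.add_le_add_left h2 _).trans (Nat.le_add_right _ _)

/-- Merging all divisors after the second into their product $c$ can only raise the codimension,
since $\sum(d_i-1)\le\prod d_i-1$, and $c$ still divides $n$; this reduces to three divisors. -/
theorem sieveBound_of_strictMono {q n k : ℕ} (hq : 2 ≤ q) (hn : n ≠ 0) (d : Fin (k + 3) → ℕ)
    (hd : StrictMono d) (hd2 : ∀ i, 2 ≤ d i) (hdn : ∀ i, d i ∣ n)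
    (hcop : ∀ i j, i ≠ j → Nat.Coprime (d i) (d j)) :
    SieveBound q n (1 + ∑ i, (d i - 1)) := by
  set c := ∏ i : Fin (k + 1), d i.succ.succ with hc
  have hpos : ∀ i, 1 ≤ d i := fun i => le_trans (by norm_num) (hd2 i)
  have hc1 : d 1 < c := by
    have h1 : d 1 < d (Fin.succ (Fin.succ 0)) := hd (Fin.succ_lt_succ_iff.2 (Fin.succ_pos 0))
    refine h1.trans_le (Nat.le_of_dvd (Finset.prod_pos fun i _ => hpos _) ?_)
    exact Finset.dvd_prod_of_mem (fun i : Fin (k + 1) => d i.succ.succ) (Finset.mem_univ 0)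
  have h01 : Nat.Coprime (d 0) (d 1) := hcop _ _ (Fin.succ_ne_zero 0).symm
  have h0c : Nat.Coprime (d 0) c :=
    Nat.Coprime.prod_right fun i _ => hcop _ _ (Fin.succ_ne_zero _).symm
  have h1c : Nat.Coprime (d 1) c :=
    Nat.Coprime.prod_right fun i _ => hcop _ _ fun h =>
      Fin.succ_ne_zero i (Fin.succ_injective _ (show Fin.succ 0 = Fin.succ i.succ from h)).symm
  have hcn : c ∣ n := by
    refine Finset.prod_dvd_of_isRelPrime (fun i _ j _ hij => ?_) fun i _ => hdn _
    exact Nat.coprime_iff_isRelPrime.1 (hcop _ _ fun h =>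
      hij (Fin.succ_injective _ (Fin.succ_injective _ h)))
  obtain ⟨m, rfl⟩ : d 0 * d 1 * c ∣ n :=
    (h0c.mul_left h1c).mul_dvd_of_dvd_of_dvd (h01.mul_dvd_of_dvd_of_dvd (hdn 0) (hdn 1)) hcn
  have hm : 1 ≤ m := Nat.one_le_iff_ne_zero.2 fun h => hn (by rw [h, mul_zero])
  refine (sieveBound_triple (hd2 0) (hd (Fin.succ_pos 0)) hc1 h01 h0c h1c hm hq).mono
    (by omega) ?_
  rw [Fin.sum_univ_succ, Fin.sum_univ_succ]
  have := sum_sub_one_le_prod_sub_one Finset.univ (fun i : Fin (k + 1) => d i.succ.succ)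
    fun i _ => hpos _
  rw [← hc] at this
  have h0 := hd2 0
  have h1 := hd2 1
  have e : d (Fin.succ (0 : Fin (k + 2))) = d 1 := rfl
  rw [e]
  omega

/-! ### Conclusion -/

theorem theorem4 (q n k : ℕ) (hq : IsPrimePow q) (hn : 1 < n) (hnp : ¬ IsPrimePow n)
    (hk : 1 < k) (hkn : k < n.divisors.card)
    (K : Type*) [Field K] [Finite K] (hK : Nat.card K = q ^ n)
    (d : Fin k → ℕ) (hd : d ∈ DivisorTuples k n)
    (hcop : ∀ i j, i < j → Nat.gcd (d i) (d j) = 1)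
    (a : Fin k → K) (ha : IsAdmissible q d a)
    (hcond : 3 ≤ k ∨
      (k = 2 ∧ PairCondition (d ⟨0, by omega⟩) (d ⟨1, by omega⟩) q)) :
    ∃ α : K, IsPrimitiveElement α ∧ ∀ i, relTrace q n (d i) α = a i := by
  have hn0 : n ≠ 0 := by omega
  have hq2 : 2 ≤ q := hq.two_le
  obtain ⟨hmono, hdiv, hnd⟩ := hd
  obtain ⟨V, α, hV, htr⟩ := exists_coset_of_traces hq hn0 hK hk d (fun i => (hdiv i).1) hcop a ha
  have hbound : SieveBound q n (1 + ∑ i, (d i - 1)) := by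
    rcases hcond with h3 | ⟨rfl, hpair⟩
    · obtain ⟨k, rfl⟩ := Nat.exists_eq_add_of_le' h3
      refine sieveBound_of_strictMono hq2 hn0 d hmono (fun i => ?_) (fun i => (hdiv i).1) ?_
      · have h0 : d i ≠ 0 := fun h => hn0 (by simpa [h] using (hdiv i).1)
        have h1 : d i ≠ 1 := by
          intro h
          obtain ⟨j, hj⟩ := exists_ne i
          exact hnd i j hj.symm (h ▸ one_dvd _)
        omega
      · intro i j hij
        rcases lt_or_gt_of_ne hij with h | h
        · exact hcop i j h
        · exact Nat.Coprime.symm (hcop j i h)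
    · have h01 : (0 : Fin 2) < 1 := by decide
      have hg : Nat.Coprime (d 0) (d 1) := hcop 0 1 h01
      obtain ⟨m, rfl⟩ : d 0 * d 1 ∣ n := hg.mul_dvd_of_dvd_of_dvd (hdiv 0).1 (hdiv 1).1
      have hm : 1 ≤ m := Nat.one_le_iff_ne_zero.2 fun h => hn0 (by rw [h, mul_zero])
      have h := sieveBound_of_pairCondition (hmono h01) hg hm hq2 hpair
      refine h.mono (by omega) ?_
      rw [Fin.sum_univ_two]
      have h0 : d 0 ≠ 0 := fun h => hn0 (by rw [h]; simp)
      have h1 : d 1 ≠ 0 := fun h => hn0 (by rw [h]; simp)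
      omega
  -- As $|V|q^\lambda=q^n$, the criterion $4^\omega q^n\le|V|^2$ becomes the sieve inequality after
  -- multiplication by $q^{2\lambda}$.
  obtain ⟨v, hv, hprim⟩ := exists_isPrimitiveElement_coset V α (by
    have hpos : 0 < q ^ (2 * (1 + ∑ i, (d i - 1))) := by positivity
    refine Nat.le_of_mul_le_mul_right ?_ hpos
    rw [hK]
    calc _ = 4 ^ (q ^ n - 1).primeFactors.card * q ^ (2 * (1 + ∑ i, (d i - 1))) * q ^ n := by ring
      _ ≤ q ^ n * q ^ n := Nat.mul_le_mul_right _ hbound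
      _ = (Nat.card V * q ^ (1 + ∑ i, (d i - 1))) ^ 2 := by rw [hV]; ring
      _ = _ := by ring)
  exact ⟨α + v, hprim, htr v hv⟩
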